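/- Let $d \ge 1$ and let $\lambda$ be Lebesgue measure on $\mathbb{R}^d$. Let $B=\{x:\|x\|_2\le 1\}$ and $C=\{x:\|x\|_\infty\le 1\}=[-1,1]^d$, and let $\omega_d=\lambda(B)$. For $A\subseteq\mathbb{R}^d$ and $r>0$ write $A_{\oplus r}=A+rB$ and $A_{\boxplus r}=A+rC$ (Minkowski sums). Let $N_B(A;r)$ (respectively $N_C(A;r)$) be the largest cardinality of a subset of $A$ whose distinct points have pairwise $\ell_2$-distance (respectively $\ell_\infty$-distance) strictly greater than $r$. For $K\in\{B,C\}$ and a measurable set $S$ of finite volume, the lower and upper $K$-surface areas of $S$ are $$\underline\lambda_K(\partial S)=\liminf_{\delta\downarrow 0}\frac{\lambda(S+\delta K)-\lambda(S)}{\delta},\qquad \overline\lambda_K(\partial S)=\limsup_{\delta\downarrow 0}\frac{\lambda(S+\delta K)-\lambda(S)}{\delta};$$ if they agree, the common value is the $K$-surface area $\lambda_K(\partial S)$, and $\lambda(\partial S)$ stands for $\lambda_B(\partial S)$. Let $A\subseteq\mathbb{R}^d$ be a finite set and let $r>0$. Then for every $\delta>0$ $$\lambda(A_{\oplus (r+\delta)}\setminus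 A_{\oplus r})\le N_B(A;r)\,2^{d-1}\omega_d\big((r+\delta)^d-r^d\big),$$ $$\lambda(A_{\boxplus (r+\delta)}\setminus A_{\boxplus r})\le N_C(A;r)\,2^{2d-1}\big((r+\delta)^d-r^d\big).$$ Moreover, the surface areas $\lambda(\partial A_{\oplus r})$ and $\lambda_C(\partial A_{\boxplus r})$ exist (the lower and upper ones agree), and $$\lambda(\partial A_{\oplus r})\le N_B(A;r)\,2^{d-1}\omega_d\,d\,r^{d-1},\qquad \lambda_C(\partial A_{\boxplus r})\le N_C(A;r)\,2^{2d-1}\,d\,r^{d-1}.$$ -/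

import Mathlib

open MeasureTheory Filter Topology
open scoped ENNReal NNReal Pointwise

noncomputable section

/-- The closed unit ball of the Euclidean norm on `ℝ^d`. -/
def unitBall (d : ℕ) : Set (EuclideanSpace ℝ (Fin d)) := {x | ‖x‖ ≤ 1}

/-- The closed unit ball of the sup norm on `ℝ^d`, that is, the cube `[-1, 1]^d`. -/
def unitCube (d : ℕ) : Set (EuclideanSpace ℝ (Fin d)) := {x | ∀ i, |x i| ≤ 1}

/-- The `r`-parallel set of `A` with respect to `K`: the Minkowski sum `A ⊕ r K`. -/
def parallelSet {d : ℕ} (K A : Set (EuclideanSpace ℝ (Fin d))) (r : ℝ) :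
    Set (EuclideanSpace ℝ (Fin d)) :=
  A + r • K

/-- Lower (Minkowski) `K`-surface area of a set `A` of finite volume: the liminf as `δ ↓ 0` of
`(vol (A ⊕ δ K) - vol A) / δ`. -/
def lowerSurfaceArea {d : ℕ} (K A : Set (EuclideanSpace ℝ (Fin d))) : ℝ≥0∞ :=
  liminf (fun δ : ℝ => (volume (parallelSet K A δ) - volume A) / ENNReal.ofReal δ) (𝓝[>] 0)

/-- Upper (Minkowski) `K`-surface area of a set `A` of finite volume: the limsup as `δ ↓ 0` of
`(vol (A ⊕ δ K) - vol A) / δ`. -/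
def upperSurfaceArea {d : ℕ} (K A : Set (EuclideanSpace ℝ (Fin d))) : ℝ≥0∞ :=
  limsup (fun δ : ℝ => (volume (parallelSet K A δ) - volume A) / ENNReal.ofReal δ) (𝓝[>] 0)

/-- The volume of the Euclidean unit ball of `ℝ^d`. -/
def unitBallVolume (d : ℕ) : ℝ := (volume (unitBall d)).toReal

/-- The `ε`-packing number of `A` for the Euclidean metric: the largest size of a subset of `A`
whose distinct points have pairwise distance `> ε`. -/
def packingNumberBall {d : ℕ} (A : Set (EuclideanSpace ℝ (Fin d))) (ε : ℝ) : ℕ∞ :=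
  Metric.packingNumber ε.toNNReal A

/-- The `ε`-packing number of `A` for the sup metric. The space `Fin d → ℝ` carries the sup
metric, and `WithLp.ofLp` is the identity on coordinates. -/
def packingNumberCube {d : ℕ} (A : Set (EuclideanSpace ℝ (Fin d))) (ε : ℝ) : ℕ∞ :=
  Metric.packingNumber ε.toNNReal (WithLp.ofLp '' A : Set (Fin d → ℝ))

end

/-! ### Polar coordinates and star-shaped sets. -/

section Polar

open Measure Module

variable {E : Type*} [NormedAddCommGroup E] [NormedSpace ℝ E] [FiniteDimensional ℝ E]
  [MeasurableSpace E] [BorelSpace E]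

/-! A maximal `r`-separated subset of `A` is an `r`-net of `A`, so the shell of `A` is covered by
the shells of the pieces of `A` in the balls of radius `r` about the net points
(`measure_shell_le_packingNumber_mul`). It remains to bound the shell of a finite set lying in one
ball of radius `r` about `s`.

For Euclidean balls, every ray from `s` meets the shell inside the part of a single ball's ray
segment gained when its radius grows from `r` to `t`; a one-variable estimate for that segment is
integrated over the sphere (`measure_shell_le_of_subset_closedBall`). For cubes, the sides are
enlarged one coordinate at a time and the gains, found by Fubini, telescope
(`volume_shell_le_of_subset_closedBall_pi`).

The surface area is the right derivative of the volume of the parallel set. It exists in any norm by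
Kneser's property (`measure_shell_mul_le`): the shell splits into pieces star-shaped about their
centres, so its volume divided by `t ^ d - r ^ d` is monotone in `t`. The surface bounds then follow
by dividing the shell bounds by `δ` and letting `δ` tend to zero. -/

/-- Volume in polar coordinates. -/
theorem measure_eq_lintegral_sphere [Nontrivial E] (μ : Measure E) [μ.IsAddHaarMeasure]
    {S : Set E} (hS : MeasurableSet S) :
    μ S = ∫⁻ u : Metric.sphere (0 : E) 1,
      volumeIoiPow (finrank ℝ E - 1) {ρ | ρ.1 • u.1 ∈ S} ∂μ.toSphere := by
  have h1 : μ S = μ.comap (Subtype.val : ({0}ᶜ : Set E) → E) (Subtype.val ⁻¹' S) := by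
    rw [comap_subtype_coe_apply (measurableSet_singleton _).compl, Subtype.image_preimage_coe,
      Set.inter_comm, ← Set.sdiff_eq, measure_sdiff_null (measure_singleton _)]
  have h2 := (μ.measurePreserving_homeomorphUnitSphereProd).symm
    (homeomorphUnitSphereProd E).toMeasurableEquiv
  have hS' : MeasurableSet (Subtype.val ⁻¹' S : Set ({0}ᶜ : Set E)) := measurable_subtype_coe hS
  rw [h1, ← h2.measure_preimage hS'.nullMeasurableSet, prod_apply (h2.measurable hS')]
  rfl

theorem volumeIoiPow_Ioc (n : ℕ) {a b : ℝ} (ha : 0 ≤ a) (hab : a ≤ b) :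
    volumeIoiPow n {ρ | a < ρ.1 ∧ ρ.1 ≤ b} =
      ENNReal.ofReal ((b ^ (n + 1) - a ^ (n + 1)) / (n + 1)) := by
  have hm : MeasurableSet {ρ : Set.Ioi (0 : ℝ) | a < ρ.1 ∧ ρ.1 ≤ b} :=
    measurable_subtype_coe measurableSet_Ioc
  have him : Subtype.val '' {ρ : Set.Ioi (0 : ℝ) | a < ρ.1 ∧ ρ.1 ≤ b} = Set.Ioc a b := by
    ext x
    simp only [Set.mem_image, Set.mem_ofPred_eq, Subtype.exists, Set.mem_Ioi, Set.mem_Ioc]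
    constructor
    · rintro ⟨y, -, hy, rfl⟩; exact hy
    · intro hx; exact ⟨x, ha.trans_lt hx.1, hx, rfl⟩
  rw [volumeIoiPow, withDensity_apply _ hm,
    setLIntegral_subtype measurableSet_Ioi _ fun a : ℝ ↦ .ofReal (a ^ n), him,
    ← ofReal_integral_eq_lintegral_ofReal (intervalIntegral.intervalIntegrable_pow _).1,
    ← intervalIntegral.integral_of_le hab]
  · simp
  · filter_upwards [ae_restrict_mem measurableSet_Ioc] with y hy
    exact pow_nonneg (ha.trans hy.1.le) _

/-- The measure of the part of a star-shaped set in the shell `r < ‖x‖ ≤ t`, relative to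
`t ^ d - r ^ d`, is nonincreasing in `t`. -/
theorem measure_starShaped_shell_mul_le [Nontrivial E] (μ : Measure E) [μ.IsAddHaarMeasure]
    {S : Set E} (hS : MeasurableSet S) (hstar : ∀ x ∈ S, ∀ θ : ℝ, 0 < θ → θ ≤ 1 → θ • x ∈ S)
    {r t t' : ℝ} (hr : 0 ≤ r) (hrt : r ≤ t) (htt' : t ≤ t') :
    μ (S ∩ {x | r < ‖x‖ ∧ ‖x‖ ≤ t'}) *
        ENNReal.ofReal (t ^ finrank ℝ E - r ^ finrank ℝ E) ≤
      μ (S ∩ {x | r < ‖x‖ ∧ ‖x‖ ≤ t}) *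
        ENNReal.ofReal (t' ^ finrank ℝ E - r ^ finrank ℝ E) := by
  have hd : 0 < finrank ℝ E := finrank_pos
  have hshell (q : ℝ) : MeasurableSet {x : E | r < ‖x‖ ∧ ‖x‖ ≤ q} :=
    (measurableSet_lt measurable_const measurable_norm).inter
      (measurableSet_le measurable_norm measurable_const)
  rw [measure_eq_lintegral_sphere μ (hS.inter (hshell _)),
    measure_eq_lintegral_sphere μ (hS.inter (hshell _)),
    ← lintegral_mul_const' _ _ ENNReal.ofReal_ne_top,
    ← lintegral_mul_const' _ _ ENNReal.ofReal_ne_top]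
  refine lintegral_mono fun u => ?_
  obtain ⟨n, hn⟩ : ∃ n, finrank ℝ E = n + 1 := ⟨finrank ℝ E - 1, by omega⟩
  have hu : ‖u.1‖ = 1 := by simp
  have hnorm (ρ : Set.Ioi (0 : ℝ)) : ‖ρ.1 • u.1‖ = ρ.1 := by
    rw [norm_smul, hu, mul_one, Real.norm_of_nonneg (le_of_lt ρ.2)]
  simp only [hn, Nat.add_sub_cancel, Set.mem_inter_iff, Set.mem_ofPred_eq, hnorm]
  have hpow : t ^ (n + 1) ≤ t' ^ (n + 1) := pow_le_pow_left₀ (hr.trans hrt) htt' _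
  have hpow' : r ^ (n + 1) ≤ t ^ (n + 1) := pow_le_pow_left₀ hr hrt _
  -- On a ray, a star-shaped set is an initial segment. Either it covers all radii in `(r, t]`, and
  -- the ratio at `t` is the largest possible, or it stops by radius `t` and gains nothing up to
  -- `t'`.
  by_cases h : ∀ ρ : Set.Ioi (0 : ℝ), r < ρ.1 → ρ.1 ≤ t → ρ.1 • u.1 ∈ S
  · have h1 : {ρ : Set.Ioi (0 : ℝ) | ρ.1 • u.1 ∈ S ∧ r < ρ.1 ∧ ρ.1 ≤ t} =
        {ρ | r < ρ.1 ∧ ρ.1 ≤ t} := by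
      ext ρ
      exact ⟨fun h' => h'.2, fun h' => ⟨h ρ h'.1 h'.2, h'⟩⟩
    rw [h1, volumeIoiPow_Ioc n hr hrt]
    refine (mul_le_mul_left (measure_mono (t := {ρ : Set.Ioi (0 : ℝ) | r < ρ.1 ∧ ρ.1 ≤ t'})
      fun ρ h => h.2) _).trans ?_
    rw [volumeIoiPow_Ioc n hr (hrt.trans htt'), ← ENNReal.ofReal_mul (by
      apply div_nonneg <;> [linarith; positivity]), ← ENNReal.ofReal_mul (by
      apply div_nonneg <;> [linarith; positivity])]
    apply le_of_eq
    congr 1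
    ring
  · push Not at h
    obtain ⟨ρ₀, h1, h2, h3⟩ := h
    refine mul_le_mul' (measure_mono ?_) (ENNReal.ofReal_le_ofReal (by linarith))
    rintro ρ ⟨hρS, hρr, -⟩
    refine ⟨hρS, hρr, ?_⟩
    by_contra! hlt
    have hρ : 0 < ρ.1 := ρ.2
    have hρ0 : 0 < ρ₀.1 := ρ₀.2
    apply h3
    have := hstar _ hρS (ρ₀.1 / ρ.1) (by positivity) (by rw [div_le_one hρ]; linarith)
    rwa [smul_smul, div_mul_cancel₀ _ hρ.ne'] at this

end Polar

/-! ### Unions of balls and reduction to a single ball via packing. -/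

/-- The union of the closed balls of radius `t` centred at the points of `A`. -/
def ballUnion {X : Type*} [PseudoMetricSpace X] (A : Set X) (t : ℝ) : Set X :=
  ⋃ a ∈ A, Metric.closedBall a t

section BallUnion

variable {X : Type*} [PseudoMetricSpace X]

theorem mem_ballUnion {A : Set X} {t : ℝ} {x : X} :
    x ∈ ballUnion A t ↔ ∃ a ∈ A, dist x a ≤ t := by
  simp [ballUnion]

theorem ballUnion_mono_right (A : Set X) {s t : ℝ} (h : s ≤ t) : ballUnion A s ⊆ ballUnion A t := by
  intro x hx
  obtain ⟨a, ha, hxa⟩ := mem_ballUnion.1 hx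
  exact mem_ballUnion.2 ⟨a, ha, hxa.trans h⟩

theorem ballUnion_mono_left {A B : Set X} (h : A ⊆ B) (t : ℝ) : ballUnion A t ⊆ ballUnion B t := by
  intro x hx
  obtain ⟨a, ha, hxa⟩ := mem_ballUnion.1 hx
  exact mem_ballUnion.2 ⟨a, h ha, hxa⟩

theorem isClosed_ballUnion {A : Set X} (hA : A.Finite) (t : ℝ) : IsClosed (ballUnion A t) :=
  hA.isClosed_biUnion fun _ _ => Metric.isClosed_closedBall

theorem measure_ballUnion_lt_top [ProperSpace X] [MeasurableSpace X] (μ : Measure X)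
    [IsFiniteMeasureOnCompacts μ] {A : Set X} (hA : A.Finite) (t : ℝ) :
    μ (ballUnion A t) < ∞ :=
  (hA.isCompact_biUnion fun a _ => isCompact_closedBall a t).measure_lt_top

theorem measure_ballUnion_sub [ProperSpace X] [MeasurableSpace X] [OpensMeasurableSpace X]
    (μ : Measure X) [IsFiniteMeasureOnCompacts μ] {A : Set X} (hA : A.Finite) {r t : ℝ}
    (hrt : r ≤ t) :
    μ (ballUnion A t) - μ (ballUnion A r) = μ (ballUnion A t \ ballUnion A r) :=
  (measure_sdiff (ballUnion_mono_right A hrt) (isClosed_ballUnion hA r).nullMeasurableSet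
    (measure_ballUnion_lt_top μ hA r).ne).symm

/-- A bound for the parallel shells of finite sets in a ball of radius `r` gives a bound for
arbitrary finite sets, at the cost of a factor that is the packing number. -/
theorem measure_shell_le_packingNumber_mul [MeasurableSpace X] (μ : Measure X) {r t : ℝ}
    (hr : 0 ≤ r) {C : ℝ≥0∞}
    (hloc : ∀ (A : Set X) (s : X), A.Finite → A ⊆ Metric.closedBall s r →
      μ (ballUnion A t \ ballUnion A r) ≤ C)
    {A : Set X} (hA : A.Finite) :
    μ (ballUnion A t \ ballUnion A r) ≤ (Metric.packingNumber r.toNNReal A : ℝ≥0∞) * C := by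
  have hfin : Metric.packingNumber r.toNNReal A ≠ ⊤ :=
    ((Metric.packingNumber_le_encard_self A).trans_lt hA.encard_lt_top).ne
  set S := Metric.maximalSeparatedSet r.toNNReal A with hSdef
  have hcov : A ⊆ ⋃ y ∈ S, Metric.closedBall y r := by
    have := (Metric.isCover_maximalSeparatedSet hfin).subset_iUnion_closedBall
    rwa [Real.coe_toNNReal r hr] at this
  have hS : S.Finite := hA.subset Metric.maximalSeparatedSet_subset
  rw [← Metric.encard_maximalSeparatedSet hfin, ← hSdef]
  -- A point near `a` is charged to a net point `s` within `r` of `a`; discarding the other centres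
  -- only shrinks the removed inner union.
  have hsub : ballUnion A t \ ballUnion A r ⊆ ⋃ s ∈ hS.toFinset,
      (ballUnion (A ∩ Metric.closedBall s r) t \ ballUnion (A ∩ Metric.closedBall s r) r) := by
    rintro x ⟨hx, hx'⟩
    obtain ⟨a, ha, hxa⟩ := mem_ballUnion.1 hx
    obtain ⟨s, hs, has⟩ := Set.mem_iUnion₂.1 (hcov ha)
    refine Set.mem_iUnion₂.2 ⟨s, hS.mem_toFinset.2 hs, mem_ballUnion.2 ⟨a, ⟨ha, has⟩, hxa⟩, fun h => ?_⟩
    exact hx' (ballUnion_mono_left Set.inter_subset_left _ h)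
  calc μ (ballUnion A t \ ballUnion A r)
      ≤ ∑ s ∈ hS.toFinset, μ (ballUnion (A ∩ Metric.closedBall s r) t \
          ballUnion (A ∩ Metric.closedBall s r) r) :=
        (measure_mono hsub).trans (measure_biUnion_finset_le _ _)
    _ ≤ ∑ _s ∈ hS.toFinset, C := Finset.sum_le_sum fun s _ =>
        hloc _ s (hA.subset Set.inter_subset_left) Set.inter_subset_right
    _ = (S.encard : ℝ≥0∞) * C := by
        rw [Finset.sum_const, nsmul_eq_mul, hS.encard_eq_coe_toFinset_card]
        simp

end BallUnion

/-! ### Kneser's property and existence of the surface area, in an arbitrary norm. -/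

section SurfaceArea

open Measure Module

variable {E : Type*} [NormedAddCommGroup E]

/-- The points for which `a k` is the first nearest point of the family `a`. -/
def firstNearestCell {n : ℕ} (a : Fin n → E) (k : Fin n) : Set E :=
  {x | (∀ j, ‖x - a k‖ ≤ ‖x - a j‖) ∧ ∀ j < k, ‖x - a k‖ < ‖x - a j‖}

/-- By the triangle inequality, moving straight towards `a k` never decreases the excess of the
distance to `a j` over the distance to `a k`. This preserves weak and strict comparisons alike, for
any norm. -/
theorem firstNearestCell_starShaped [NormedSpace ℝ E] {n : ℕ} (a : Fin n → E) (k : Fin n)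
    {y : E} (hy : y + a k ∈ firstNearestCell a k) {θ : ℝ} (hθ : 0 < θ) (hθ1 : θ ≤ 1) :
    θ • y + a k ∈ firstNearestCell a k := by
  have key (j : Fin n) : ‖y + a k - a j‖ - ‖y‖ ≤ ‖θ • y + a k - a j‖ - ‖θ • y‖ := by
    have h1 : y + a k - a j = (θ • y + a k - a j) + (1 - θ) • y := by module
    have h2 : ‖y + a k - a j‖ ≤ ‖θ • y + a k - a j‖ + ‖(1 - θ) • y‖ := by
      rw [h1]; exact norm_add_le _ _
    rw [norm_smul, Real.norm_of_nonneg (by linarith)] at h2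
    rw [norm_smul, Real.norm_of_nonneg hθ.le]
    linarith
  obtain ⟨h1, h2⟩ := hy
  constructor
  · intro j
    have := h1 j
    have := key j
    simp only [add_sub_cancel_right] at *
    linarith
  · intro j hj
    have := h2 j hj
    have := key j
    simp only [add_sub_cancel_right] at *
    linarith

theorem measurableSet_firstNearestCell [MeasurableSpace E] [BorelSpace E] {n : ℕ}
    (a : Fin n → E) (k : Fin n) :
    MeasurableSet (firstNearestCell a k) := by
  have h (j : Fin n) : Continuous fun x => ‖x - a j‖ := by fun_prop
  refine MeasurableSet.inter (s₁ := {x | ∀ j, ‖x - a k‖ ≤ ‖x - a j‖})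
    (s₂ := {x | ∀ j < k, ‖x - a k‖ < ‖x - a j‖}) ?_ ?_
  · rw [Set.ofPred_forall]
    exact MeasurableSet.iInter fun j => (isClosed_le (h k) (h j)).measurableSet
  · rw [Set.ofPred_forall]
    refine MeasurableSet.iInter fun j => ?_
    rw [Set.ofPred_forall]
    exact MeasurableSet.iInter fun _ => (isOpen_lt (h k) (h j)).measurableSet

variable [MeasurableSpace E] [BorelSpace E]

/-- On the cell of `a k` the distance to the whole family is the distance to `a k`, so the shell
becomes a spherical one. Breaking ties by the first index makes the cells truly disjoint; bisectors
cannot be neglected, since for the sup norm they may have positive volume. -/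
theorem measure_shell_eq_sum {n : ℕ} (μ : Measure E) [μ.IsAddHaarMeasure] (a : Fin n → E)
    (r t : ℝ) :
    μ (ballUnion (Set.range a) t \ ballUnion (Set.range a) r) =
      ∑ k, μ ({y | y + a k ∈ firstNearestCell a k} ∩ {y | r < ‖y‖ ∧ ‖y‖ ≤ t}) := by
  have hU : ballUnion (Set.range a) t \ ballUnion (Set.range a) r =
      ⋃ k, firstNearestCell a k ∩ {x | r < ‖x - a k‖ ∧ ‖x - a k‖ ≤ t} := by
    ext x
    simp only [Set.mem_sdiff, mem_ballUnion, Set.exists_range_iff, Set.mem_iUnion, Set.mem_inter_iff,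
      Set.mem_ofPred_eq, dist_eq_norm]
    constructor
    · rintro ⟨⟨k, hk⟩, hr⟩
      push Not at hr
      classical
      obtain ⟨m, -, hm⟩ := Finset.exists_min_image Finset.univ (fun j => ‖x - a j‖) ⟨k, by simp⟩
      obtain ⟨m₀, hm₀, hmin⟩ := Finset.exists_minimal
        (s := Finset.univ.filter fun j => ‖x - a j‖ ≤ ‖x - a m‖) ⟨m, by simp⟩
      have h0 : ‖x - a m₀‖ ≤ ‖x - a m‖ := by simpa using hm₀
      refine ⟨m₀, ⟨fun j => h0.trans (hm j (by simp)), fun j hj => ?_⟩, hr _,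
        h0.trans ((hm k (by simp)).trans hk)⟩
      by_contra! hle
      exact absurd (hmin (by simpa using hle.trans h0) hj.le) (not_le.2 hj)
    · rintro ⟨k, ⟨h1, -⟩, h3, h4⟩
      refine ⟨⟨k, h4⟩, ?_⟩
      push Not
      exact fun j => h3.trans_le (h1 j)
  have hm (k : Fin n) : MeasurableSet
      (firstNearestCell a k ∩ {x | r < ‖x - a k‖ ∧ ‖x - a k‖ ≤ t}) := by
    have h : Measurable fun x => ‖x - a k‖ :=
      (show Continuous fun x => ‖x - a k‖ by fun_prop).measurable
    exact (measurableSet_firstNearestCell a k).inter (h measurableSet_Ioc)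
  rw [hU, measure_iUnion ?_ hm, tsum_fintype]
  · refine Finset.sum_congr rfl fun k _ => ?_
    rw [← measure_preimage_add_right μ (a k)]
    congr 1
    ext y
    simp
  · intro i j hij
    refine Set.disjoint_left.2 fun x ⟨⟨h1, h2⟩, _⟩ ⟨⟨h3, h4⟩, _⟩ => ?_
    rcases lt_or_gt_of_ne hij with h | h
    · exact absurd (h4 i h) (not_lt.2 (h1 j))
    · exact absurd (h2 j h) (not_lt.2 (h3 i))

variable [NormedSpace ℝ E] [FiniteDimensional ℝ E] [Nontrivial E] (μ : Measure E)
  [μ.IsAddHaarMeasure]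

/-- The Kneser property: the measure of the parallel shell of a finite set between the radii `r`
and `t`, relative to `t ^ d - r ^ d`, is nonincreasing in `t`. -/
theorem measure_shell_mul_le {A : Set E} (hA : A.Finite) {r t t' : ℝ} (hr : 0 ≤ r) (hrt : r ≤ t)
    (htt' : t ≤ t') :
    μ (ballUnion A t' \ ballUnion A r) * ENNReal.ofReal (t ^ finrank ℝ E - r ^ finrank ℝ E) ≤
      μ (ballUnion A t \ ballUnion A r) *
        ENNReal.ofReal (t' ^ finrank ℝ E - r ^ finrank ℝ E) := by
  obtain ⟨n, a, -, rfl⟩ := hA.fin_param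
  rw [measure_shell_eq_sum, measure_shell_eq_sum, Finset.sum_mul, Finset.sum_mul]
  refine Finset.sum_le_sum fun k _ => measure_starShaped_shell_mul_le μ ?_ ?_ hr hrt htt'
  · exact (measurable_id.add_const (a k)) (measurableSet_firstNearestCell a k)
  · exact fun y hy θ hθ hθ1 => firstNearestCell_starShaped a k hy hθ hθ1

theorem tendsto_pow_slope (d : ℕ) (r : ℝ) :
    Tendsto (fun δ : ℝ => ((r + δ) ^ d - r ^ d) / δ) (𝓝[>] 0) (𝓝 (d * r ^ (d - 1))) := by
  have h := (hasDerivAt_pow d r).tendsto_slope_zero_right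
  refine h.congr fun δ => ?_
  rw [smul_eq_mul, div_eq_inv_mul]


/-- The right derivative of the volume of the parallel sets of a finite set exists. -/
theorem exists_tendsto_measure_ballUnion_sub_div {A : Set E} (hA : A.Finite) {r : ℝ} (hr : 0 < r) :
    ∃ l : ℝ≥0∞, Tendsto (fun δ : ℝ => (μ (ballUnion A (r + δ)) - μ (ballUnion A r)) /
      ENNReal.ofReal δ) (𝓝[>] 0) (𝓝 l) := by
  set d := finrank ℝ E with hd
  have hd0 : 0 < d := finrank_pos
  have hpow {δ : ℝ} (hδ : 0 < δ) : 0 < (r + δ) ^ d - r ^ d :=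
    sub_pos.2 (pow_lt_pow_left₀ (by linarith) hr.le hd0.ne')
  set q : ℝ → ℝ≥0∞ := fun δ => μ (ballUnion A (r + δ) \ ballUnion A r) /
    ENNReal.ofReal ((r + δ) ^ d - r ^ d) with hq
  have hanti : AntitoneOn q (Set.Ioi 0) := by
    intro δ hδ δ' hδ' hle
    have hδ : 0 < δ := hδ
    have hδ' : 0 < δ' := hδ'
    have h := measure_shell_mul_le μ hA hr.le (show r ≤ r + δ by linarith)
      (show r + δ ≤ r + δ' by linarith)
    rw [← hd] at h
    have h0 : ENNReal.ofReal ((r + δ) ^ d - r ^ d) ≠ 0 := (ENNReal.ofReal_pos.2 (hpow hδ)).ne'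
    have h0' : ENNReal.ofReal ((r + δ') ^ d - r ^ d) ≠ 0 := (ENNReal.ofReal_pos.2 (hpow hδ')).ne'
    rw [hq]
    refine (ENNReal.div_le_iff h0' ENNReal.ofReal_ne_top).2 ?_
    rw [← ENNReal.mul_div_right_comm]
    exact (ENNReal.le_div_iff_mul_le (Or.inl h0) (Or.inl ENNReal.ofReal_ne_top)).2 h
  have hlim := hanti.tendsto_nhdsGT (OrderTop.bddAbove _)
  have hslope := (ENNReal.continuous_ofReal.tendsto _).comp (tendsto_pow_slope d r)
  -- The limit of `q` has not been shown finite, so the product rule needs this factor nonzero to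
  -- exclude `∞ * 0`.
  have hpos : 0 < (d : ℝ) * r ^ (d - 1) := by positivity
  refine ⟨_, (ENNReal.Tendsto.mul hlim (Or.inr ENNReal.ofReal_ne_top) hslope
    (Or.inl (ENNReal.ofReal_pos.2 hpos).ne')).congr' ?_⟩
  filter_upwards [self_mem_nhdsWithin] with δ hδ
  have hδ : 0 < δ := hδ
  rw [measure_ballUnion_sub μ hA (by linarith), Function.comp_apply,
    ENNReal.ofReal_div_of_pos hδ, hq, ← mul_div_assoc]
  congr 1
  exact ENNReal.div_mul_cancel (ENNReal.ofReal_pos.2 (hpow hδ)).ne' ENNReal.ofReal_ne_top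

theorem liminf_eq_limsup_and_limsup_le_of_shell_le {A : Set E} (hA : A.Finite) {r : ℝ}
    (hr : 0 < r) {N : ℝ≥0∞} (hN : N ≠ ∞) {c : ℝ}
    (hshell : ∀ δ : ℝ, 0 < δ → μ (ballUnion A (r + δ) \ ballUnion A r) ≤
      N * ENNReal.ofReal (c * ((r + δ) ^ finrank ℝ E - r ^ finrank ℝ E))) :
    liminf (fun δ : ℝ => (μ (ballUnion A (r + δ)) - μ (ballUnion A r)) / ENNReal.ofReal δ)
        (𝓝[>] 0) =
      limsup (fun δ : ℝ => (μ (ballUnion A (r + δ)) - μ (ballUnion A r)) / ENNReal.ofReal δ)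
        (𝓝[>] 0) ∧
    limsup (fun δ : ℝ => (μ (ballUnion A (r + δ)) - μ (ballUnion A r)) / ENNReal.ofReal δ)
        (𝓝[>] 0) ≤
      N * ENNReal.ofReal (c * finrank ℝ E * r ^ (finrank ℝ E - 1)) := by
  obtain ⟨l, hl⟩ := exists_tendsto_measure_ballUnion_sub_div μ hA hr
  refine ⟨hl.liminf_eq.trans hl.limsup_eq.symm, ?_⟩
  rw [hl.limsup_eq, mul_assoc]
  have h := ENNReal.Tendsto.const_mul (a := N) ((ENNReal.continuous_ofReal.tendsto _).comp
    ((tendsto_pow_slope (finrank ℝ E) r).const_mul c)) (Or.inr hN)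
  refine le_of_tendsto_of_tendsto hl h ?_
  filter_upwards [self_mem_nhdsWithin] with δ hδ
  have hδ : 0 < δ := hδ
  rw [measure_ballUnion_sub μ hA (by linarith), Function.comp_apply, ← mul_div_assoc,
    ENNReal.ofReal_div_of_pos hδ, ← mul_div_assoc]
  exact ENNReal.div_le_div_right (hshell δ hδ) _

end SurfaceArea

/-! ### The local bound for Euclidean balls, along rays. -/

section Euclidean

open Measure Module

/-- Here `c` stands for `⟪u, b⟫` and `α` for `‖b‖`. With `s` the root at radius `x`, the derivative
in `x` of the `d`-th power on the left is `d * (c + s) ^ (d - 1) * x / s`. Since `|c| ≤ s ≤ x`, one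
factor `c + s ≤ 2 * s` cancels the singular `1 / s` and the other `d - 2` are at most `2 * x`; this
is where `2 ≤ d` enters. -/
theorem radial_pow_sub_le {d : ℕ} (hd : 2 ≤ d) {c α r t : ℝ} (hc : |c| ≤ α) (hα : α ≤ r)
    (hr : 0 < r) (hrt : r ≤ t) :
    (c + √(c ^ 2 + t ^ 2 - α ^ 2)) ^ d - (c + √(c ^ 2 + r ^ 2 - α ^ 2)) ^ d ≤
      2 ^ (d - 1) * (t ^ d - r ^ d) := by
  have hα0 : 0 ≤ α := (abs_nonneg c).trans hc
  have hcα : c ^ 2 ≤ α ^ 2 := sq_le_sq' (by linarith [neg_abs_le c]) ((le_abs_self c).trans hc)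
  obtain ⟨k, rfl⟩ : ∃ k, d = k + 2 := ⟨d - 2, by omega⟩
  have hmono : MonotoneOn
      (fun x : ℝ => 2 ^ (k + 1) * x ^ (k + 2) - (c + √(c ^ 2 + x ^ 2 - α ^ 2)) ^ (k + 2))
      (Set.Ici r) := by
    -- Differentiability is needed only for `x > r`: at `x = r` the root may vanish.
    refine monotoneOn_of_hasDerivWithinAt_nonneg (convex_Ici r) (by fun_prop)
      (f' := fun x => 2 ^ (k + 1) * ((k + 2 : ℕ) * x ^ (k + 1)) -
        (k + 2 : ℕ) * (c + √(c ^ 2 + x ^ 2 - α ^ 2)) ^ (k + 1) *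
          (2 * x / (2 * √(c ^ 2 + x ^ 2 - α ^ 2)))) ?_ ?_
    · intro x hx
      rw [interior_Ici] at hx
      have hx : r < x := hx
      have hpos : 0 < c ^ 2 + x ^ 2 - α ^ 2 := by nlinarith [sq_nonneg c]
      have h1 : HasDerivAt (fun x : ℝ => c ^ 2 + x ^ 2 - α ^ 2) (2 * x) x := by
        simpa using ((hasDerivAt_pow 2 x).const_add (c ^ 2)).sub_const (α ^ 2)
      have h2 := ((h1.sqrt hpos.ne').const_add c).pow (k + 2)
      have h3 := (hasDerivAt_pow (k + 2) x).const_mul ((2 : ℝ) ^ (k + 1))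
      exact (h3.sub h2).hasDerivWithinAt
    · intro x hx
      rw [interior_Ici] at hx
      have hx : r < x := hx
      have hpos : 0 < c ^ 2 + x ^ 2 - α ^ 2 := by nlinarith [sq_nonneg c]
      set s := √(c ^ 2 + x ^ 2 - α ^ 2) with hs
      have hs0 : 0 < s := Real.sqrt_pos.2 hpos
      have hcs : |c| ≤ s := Real.le_sqrt_of_sq_le (by rw [sq_abs]; nlinarith)
      have hsx : s ≤ x := (Real.sqrt_le_left (by linarith)).2 (by linarith)
      have h0 : 0 ≤ c + s := by linarith [neg_abs_le c]
      have h1 : c + s ≤ 2 * x := by linarith [le_abs_self c]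
      have h2 : c + s ≤ 2 * s := by linarith [le_abs_self c]
      have hx0 : 0 ≤ x := by linarith
      have h3 : (c + s) ^ (k + 1) * x ≤ 2 ^ (k + 1) * x ^ (k + 1) * s := by
        calc (c + s) ^ (k + 1) * x = (c + s) ^ k * (c + s) * x := by ring
          _ ≤ (2 * x) ^ k * (2 * s) * x := by gcongr
          _ = 2 ^ (k + 1) * x ^ (k + 1) * s := by rw [mul_pow]; ring
      have h4 : (c + s) ^ (k + 1) * (2 * x / (2 * s)) ≤ 2 ^ (k + 1) * x ^ (k + 1) := by
        rw [mul_div_mul_left _ _ two_ne_zero, ← mul_div_assoc, div_le_iff₀ hs0]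
        exact h3
      have h5 : (0 : ℝ) ≤ (k + 2 : ℕ) := by positivity
      have h6 := mul_le_mul_of_nonneg_left h4 h5
      nlinarith
  have h := hmono (Set.mem_Ici.2 le_rfl) (Set.mem_Ici.2 hrt) hrt
  simp only at h
  rw [show k + 2 - 1 = k + 1 by omega]
  linarith

variable {E : Type*} [NormedAddCommGroup E] [InnerProductSpace ℝ E]

/-- The radial function, in the direction `u`, of a ball that contains the origin. -/
theorem norm_smul_sub_le_iff_le_radial {u b : E} {ρ t : ℝ} (hu : ‖u‖ = 1) (hb : ‖b‖ ≤ t)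
    (hρ : 0 < ρ) :
    ‖ρ • u - b‖ ≤ t ↔ ρ ≤ inner ℝ u b + √(inner ℝ u b ^ 2 + t ^ 2 - ‖b‖ ^ 2) := by
  have ht : 0 ≤ t := (norm_nonneg b).trans hb
  set c : ℝ := inner ℝ u b with hc
  have hsq : ‖ρ • u - b‖ ^ 2 = ρ ^ 2 - 2 * ρ * c + ‖b‖ ^ 2 := by
    rw [norm_sub_sq_real, norm_smul, hu, mul_one, Real.norm_of_nonneg hρ.le, real_inner_smul_left]
    ring
  have hbt : ‖b‖ ^ 2 ≤ t ^ 2 := pow_le_pow_left₀ (norm_nonneg _) hb 2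
  have hcs : |c| ≤ √(c ^ 2 + t ^ 2 - ‖b‖ ^ 2) := Real.le_sqrt_of_sq_le (by rw [sq_abs]; linarith)
  rw [← sq_le_sq₀ (norm_nonneg _) ht, hsq,
    show ρ ^ 2 - 2 * ρ * c + ‖b‖ ^ 2 ≤ t ^ 2 ↔ (ρ - c) ^ 2 ≤ c ^ 2 + t ^ 2 - ‖b‖ ^ 2 by
      constructor <;> intro h <;> linarith,
    ← sq_abs (ρ - c), ← Real.le_sqrt (abs_nonneg _), abs_le]
  · constructor
    · rintro ⟨-, h⟩; linarith
    · intro h; exact ⟨by linarith [le_abs_self c], by linarith⟩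
  · nlinarith [sq_nonneg c]

variable [FiniteDimensional ℝ E] [Nontrivial E]

theorem radial_pow_finrank_sub_le {u b : E} {r t : ℝ} (hu : ‖u‖ = 1) (hb : ‖b‖ ≤ r) (hr : 0 < r)
    (hrt : r ≤ t) :
    (inner ℝ u b + √(inner ℝ u b ^ 2 + t ^ 2 - ‖b‖ ^ 2)) ^ finrank ℝ E -
        (inner ℝ u b + √(inner ℝ u b ^ 2 + r ^ 2 - ‖b‖ ^ 2)) ^ finrank ℝ E ≤
      2 ^ (finrank ℝ E - 1) * (t ^ finrank ℝ E - r ^ finrank ℝ E) := by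
  have hd : 0 < finrank ℝ E := finrank_pos
  rcases (show finrank ℝ E = 1 ∨ 2 ≤ finrank ℝ E by omega) with h1 | h2
  -- In dimension one `b` is a multiple of `u`, the roots are `t` and `r`, and equality holds.
  · have hu0 : u ≠ 0 := by rintro rfl; simp at hu
    obtain ⟨x, rfl⟩ := (finrank_eq_one_iff_of_nonzero' u hu0).1 h1 b
    have hin : inner ℝ u (x • u) = x := by
      rw [real_inner_smul_right, real_inner_self_eq_norm_sq, hu]; ring
    have hn : ‖x • u‖ ^ 2 = x ^ 2 := by rw [norm_smul, hu, mul_one, Real.norm_eq_abs, sq_abs]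
    rw [h1, hin, hn, add_sub_cancel_left, add_sub_cancel_left, Real.sqrt_sq hr.le,
      Real.sqrt_sq (hr.le.trans hrt)]
    apply le_of_eq
    ring
  · refine radial_pow_sub_le h2 ?_ hb hr hrt
    simpa [hu] using abs_real_inner_le_norm u b

variable [MeasurableSpace E] [BorelSpace E] (μ : Measure E) [μ.IsAddHaarMeasure]

/-- Each ray from `s` meets the shell in a set of radii that is dominated by the corresponding
interval of a single ball. -/
theorem measure_shell_le_of_subset_closedBall {A : Set E} (hA : A.Finite) {s : E} {r t : ℝ}
    (hr : 0 < r) (hrt : r ≤ t) (hAs : A ⊆ Metric.closedBall s r) :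
    μ (ballUnion A t \ ballUnion A r) ≤
      ENNReal.ofReal (2 ^ (finrank ℝ E - 1) * (t ^ finrank ℝ E - r ^ finrank ℝ E)) *
        μ (Metric.ball 0 1) := by
  rcases A.eq_empty_or_nonempty with rfl | hne
  · simp [ballUnion]
  obtain ⟨n, hn⟩ : ∃ n, finrank ℝ E = n + 1 :=
    ⟨finrank ℝ E - 1, by have : 0 < finrank ℝ E := finrank_pos; omega⟩
  have hm : MeasurableSet ((fun y => y + s) ⁻¹' (ballUnion A t \ ballUnion A r)) :=
    (measurable_id.add_const s)
      ((isClosed_ballUnion hA t).measurableSet.diff (isClosed_ballUnion hA r).measurableSet)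
  rw [← measure_preimage_add_right μ s, measure_eq_lintegral_sphere μ hm]
  have hslice (u : Metric.sphere (0 : E) 1) :
      volumeIoiPow (finrank ℝ E - 1) {ρ | ρ.1 • u.1 ∈
        (fun y => y + s) ⁻¹' (ballUnion A t \ ballUnion A r)} ≤
      ENNReal.ofReal (2 ^ (finrank ℝ E - 1) * (t ^ finrank ℝ E - r ^ finrank ℝ E) /
        finrank ℝ E) := by
    have hu : ‖u.1‖ = 1 := by simp
    set R : E → ℝ → ℝ := fun b q => inner ℝ u.1 b + √(inner ℝ u.1 b ^ 2 + q ^ 2 - ‖b‖ ^ 2) with hR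
    have hball {a : E} (ha : a ∈ A) : ‖a - s‖ ≤ r := by simpa [dist_eq_norm] using hAs ha
    have hmem {a : E} (ha : a ∈ A) {q : ℝ} (hq : r ≤ q) (ρ : Set.Ioi (0 : ℝ)) :
        dist (ρ.1 • u.1 + s) a ≤ q ↔ ρ.1 ≤ R (a - s) q := by
      rw [dist_eq_norm, ← norm_smul_sub_le_iff_le_radial hu ((hball ha).trans hq) ρ.2]
      congr! 2
      abel
    -- The ball reaching farthest at the outer radius `t` bounds the slice from above. Its own inner
    -- ball contains `s`, hence removes every radius up to `R (a - s) r`, so `a` need not be maximal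
    -- at radius `r`.
    obtain ⟨a, ha, hmax⟩ := hA.exists_maximalFor (fun a => R (a - s) t) A hne
    have hR0 : 0 ≤ R (a - s) r := by
      have : |inner ℝ u.1 (a - s)| ≤ √(inner ℝ u.1 (a - s) ^ 2 + r ^ 2 - ‖a - s‖ ^ 2) := by
        refine Real.le_sqrt_of_sq_le ?_
        rw [sq_abs]
        have := pow_le_pow_left₀ (norm_nonneg _) (hball ha) 2
        linarith
      simp only [hR]
      linarith [neg_abs_le (inner ℝ u.1 (a - s))]
    have hRR : R (a - s) r ≤ R (a - s) t := by
      simp only [hR]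
      gcongr
    have hsub : {ρ : Set.Ioi (0 : ℝ) | ρ.1 • u.1 ∈
        (fun y => y + s) ⁻¹' (ballUnion A t \ ballUnion A r)} ⊆
        {ρ | R (a - s) r < ρ.1 ∧ ρ.1 ≤ R (a - s) t} := by
      rintro ρ ⟨h1, h2⟩
      obtain ⟨b, hb, hρb⟩ := mem_ballUnion.1 h1
      constructor
      · by_contra! hle
        exact h2 (mem_ballUnion.2 ⟨a, ha, (hmem ha le_rfl ρ).2 hle⟩)
      · refine ((hmem hb hrt ρ).1 hρb).trans ?_
        rcases le_total (R (b - s) t) (R (a - s) t) with h | h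
        · exact h
        · exact hmax hb h
    refine (measure_mono hsub).trans ?_
    have hineq := radial_pow_finrank_sub_le hu (hball ha) hr hrt
    rw [hn] at hineq ⊢
    rw [Nat.add_sub_cancel, volumeIoiPow_Ioc n hR0 hRR, Nat.cast_add, Nat.cast_one]
    exact ENNReal.ofReal_le_ofReal (div_le_div_of_nonneg_right hineq (by positivity))
  refine (lintegral_mono hslice).trans ?_
  -- The sphere has total mass `finrank ℝ E` times that of the unit ball, which cancels the
  -- denominator.
  rw [lintegral_const, toSphere_apply_univ, ← mul_assoc, ← ENNReal.ofReal_natCast (finrank ℝ E),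
    ← ENNReal.ofReal_mul' (by positivity), div_mul_cancel₀]
  rw [hn]; positivity

end Euclidean

/-! ### The local bound for cubes, one coordinate at a time. -/

section Cube

/-- The union of the axis-parallel boxes with half side lengths `τ` centred at the points of `A`. -/
def boxUnion {ι : Type*} (A : Set (ι → ℝ)) (τ : ι → ℝ) : Set (ι → ℝ) :=
  ⋃ a ∈ A, Set.Icc (a - τ) (a + τ)

theorem mem_boxUnion {ι : Type*} {A : Set (ι → ℝ)} {τ x : ι → ℝ} :
    x ∈ boxUnion A τ ↔ ∃ a ∈ A, ∀ i, |x i - a i| ≤ τ i := by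
  simp only [boxUnion, Set.mem_iUnion₂, Set.mem_Icc, Pi.le_def, Pi.sub_apply, Pi.add_apply,
    ← forall_and, exists_prop, abs_le]
  refine exists_congr fun a => and_congr_right fun _ => forall_congr' fun i => ?_
  constructor <;> rintro ⟨h1, h2⟩ <;> constructor <;> linarith

theorem isClosed_boxUnion {ι : Type*} {A : Set (ι → ℝ)} (hA : A.Finite) (τ : ι → ℝ) :
    IsClosed (boxUnion A τ) :=
  hA.isClosed_biUnion fun _ _ => isClosed_Icc

theorem boxUnion_const {ι : Type*} [Fintype ι] (A : Set (ι → ℝ)) {t : ℝ} (ht : 0 ≤ t) :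
    boxUnion A (fun _ => t) = ballUnion A t := by
  ext x
  simp [mem_boxUnion, mem_ballUnion, dist_pi_le_iff ht, Real.dist_eq]

/-- A union of finitely many intervals of half length `q` with a common point grows by at most
`2 * (q' - q)` when `q` is replaced by `q'`. -/
theorem volume_interval_shell_le {F : Set ℝ} (hF : F.Finite) {s q q' : ℝ} (hqq' : q ≤ q')
    (hs : ∀ a ∈ F, |s - a| ≤ q) :
    volume {x : ℝ | (∃ a ∈ F, |x - a| ≤ q') ∧ ∀ a ∈ F, q < |x - a|} ≤
      ENNReal.ofReal (2 * (q' - q)) := by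
  rcases F.eq_empty_or_nonempty with rfl | hne
  · simp
  obtain ⟨M, hM, hMmax⟩ := hF.exists_maximalFor id F hne
  obtain ⟨m, hm, hmmin⟩ := hF.exists_minimalFor id F hne
  have hle {a : ℝ} (ha : a ∈ F) : a ≤ M := (le_total a M).elim id fun h => hMmax ha h
  have hge {a : ℝ} (ha : a ∈ F) : m ≤ a := (le_total m a).elim id fun h => hmmin ha h
  -- The intervals of half length `q` all contain `s`, so their union has no gaps and growth occurs
  -- only beyond the two extreme centres.
  have hsub : {x : ℝ | (∃ a ∈ F, |x - a| ≤ q') ∧ ∀ a ∈ F, q < |x - a|} ⊆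
      Set.Icc (M + q) (M + q') ∪ Set.Icc (m - q') (m - q) := by
    rintro x ⟨⟨b, hb, hxb⟩, hx⟩
    rw [abs_le] at hxb
    have h1 := abs_le.1 (hs M hM)
    have h2 := abs_le.1 (hs m hm)
    have h3 := hle hb
    have h4 := hge hb
    rcases le_total s x with h | h
    · left
      rcases lt_abs.1 (hx M hM) with h5 | h5
      · constructor <;> linarith
      · linarith
    · right
      rcases lt_abs.1 (hx m hm) with h5 | h5
      · linarith
      · constructor <;> linarith
  refine (measure_mono hsub).trans ((measure_union_le _ _).trans ?_)
  rw [Real.volume_Icc, Real.volume_Icc, ← ENNReal.ofReal_add (by linarith) (by linarith)]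
  apply le_of_eq
  congr 1
  ring

/-- The volume gained by enlarging one side of the boxes. -/
theorem volume_boxUnion_update_sdiff_le {n : ℕ} {A : Set (Fin (n + 1) → ℝ)} (hA : A.Finite)
    {s : Fin (n + 1) → ℝ} {r : ℝ} (hAs : ∀ a ∈ A, ∀ i, |s i - a i| ≤ r) (hr : 0 ≤ r)
    {τ : Fin (n + 1) → ℝ} (hτ : ∀ i, r ≤ τ i) (i : Fin (n + 1)) {q : ℝ} (hq : τ i ≤ q) :
    volume (boxUnion A (Function.update τ i q) \ boxUnion A τ) ≤
      ENNReal.ofReal (∏ j, (2 * (r + Function.update τ i q j)) - ∏ j, (2 * (r + τ j))) := by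
  set D := boxUnion A (Function.update τ i q) \ boxUnion A τ with hD
  have hDm : MeasurableSet D :=
    (isClosed_boxUnion hA _).measurableSet.diff (isClosed_boxUnion hA _).measurableSet
  have he := (volume_preserving_piFinSuccAbove (fun _ : Fin (n + 1) => ℝ) i).symm
  rw [← he.measure_preimage hDm.nullMeasurableSet]
  change (volume.prod volume) _ ≤ _
  rw [Measure.prod_apply_symm (he.measurable hDm)]
  -- A line in direction `i` can meet the new region only over `Q`, because centres lie within `r`
  -- of `s` in each coordinate. Each such line gains at most `2 * (q - τ i)`, so the gain is a
  -- difference of products in which only the factor `i` changes.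
  set Q : Set (Fin n → ℝ) := Set.univ.pi fun j =>
    Set.Icc (s (i.succAbove j) - (r + τ (i.succAbove j))) (s (i.succAbove j) + (r + τ (i.succAbove j)))
    with hQ
  have hQm : MeasurableSet Q := MeasurableSet.univ_pi fun _ => measurableSet_Icc
  have hslice (y : Fin n → ℝ) :
      volume ((fun x : ℝ => (x, y)) ⁻¹'
        ((MeasurableEquiv.piFinSuccAbove (fun _ : Fin (n + 1) => ℝ) i).symm ⁻¹' D)) ≤
      Q.indicator (fun _ => ENNReal.ofReal (2 * (q - τ i))) y := by
    set F : Set (Fin (n + 1) → ℝ) :=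
      {a ∈ A | ∀ j, |y j - a (i.succAbove j)| ≤ τ (i.succAbove j)} with hF
    have hFA : F ⊆ A := fun a ha => ha.1
    have hset : (fun x : ℝ => (x, y)) ⁻¹'
        ((MeasurableEquiv.piFinSuccAbove (fun _ : Fin (n + 1) => ℝ) i).symm ⁻¹' D) =
        {x : ℝ | (∃ b ∈ (fun a => a i) '' F, |x - b| ≤ q) ∧
          ∀ b ∈ (fun a => a i) '' F, τ i < |x - b|} := by
      ext x
      have hins : (MeasurableEquiv.piFinSuccAbove (fun _ : Fin (n + 1) => ℝ) i).symm (x, y) =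
        i.insertNth x y := rfl
      simp only [Set.mem_preimage, hins, hD, Set.mem_sdiff, mem_boxUnion, Set.mem_ofPred_eq,
        Set.exists_mem_image, Set.forall_mem_image, Fin.forall_iff_succAbove i,
        Fin.insertNth_apply_same, Fin.insertNth_apply_succAbove, Function.update_self, hF,
        Function.update_of_ne (Fin.succAbove_ne i _)]
      constructor
      · rintro ⟨⟨a, ha, h1, h2⟩, h3⟩
        push Not at h3
        refine ⟨⟨a, ⟨ha, h2⟩, h1⟩, fun b hb => ?_⟩
        by_contra! hle
        obtain ⟨j, hj⟩ := h3 b hb.1 hle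
        exact absurd (hb.2 j) (not_le.2 hj)
      · rintro ⟨⟨a, ⟨ha, h2⟩, h1⟩, h3⟩
        refine ⟨⟨a, ha, h1, h2⟩, ?_⟩
        rintro ⟨b, hb, h4, h5⟩
        exact absurd h4 (not_le.2 (h3 ⟨hb, h5⟩))
    rw [hset]
    by_cases hy : y ∈ Q
    · rw [Set.indicator_of_mem hy]
      refine volume_interval_shell_le (s := s i) ((hA.subset hFA).image _) hq ?_
      rintro _ ⟨a, ha, rfl⟩
      exact (hAs a (hFA ha) i).trans (hτ i)
    · rw [Set.indicator_of_notMem hy, nonpos_iff_eq_zero]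
      convert measure_empty (μ := (volume : Measure ℝ))
      rw [Set.eq_empty_iff_forall_notMem]
      rintro x ⟨⟨_, ⟨a, ha, rfl⟩, -⟩, -⟩
      refine hy fun j _ => ?_
      have h1 := abs_le.1 (ha.2 j)
      have h2 := abs_le.1 (hAs a ha.1 (i.succAbove j))
      constructor <;> linarith
  refine (lintegral_mono hslice).trans ?_
  have hvol : volume Q = ENNReal.ofReal (∏ j, (2 * (r + τ (i.succAbove j)))) := by
    rw [hQ, volume_pi_pi, ENNReal.ofReal_prod_of_nonneg
      fun j _ => by linarith [hτ (i.succAbove j)]]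
    refine Finset.prod_congr rfl fun j _ => ?_
    rw [Real.volume_Icc]
    congr 1
    ring
  rw [lintegral_indicator_const hQm, hvol, ← ENNReal.ofReal_mul (by linarith)]
  apply le_of_eq
  congr 1
  rw [Fin.prod_univ_succAbove _ i, Fin.prod_univ_succAbove _ i]
  simp only [Function.update_self, Function.update_of_ne (Fin.succAbove_ne i _)]
  ring

/-- Enlarging the sides in `T` successively makes the differences of products telescope. -/
theorem volume_boxUnion_piecewise_sdiff_le {n : ℕ} {A : Set (Fin (n + 1) → ℝ)} (hA : A.Finite)
    {s : Fin (n + 1) → ℝ} {r t : ℝ} (hAs : ∀ a ∈ A, ∀ i, |s i - a i| ≤ r) (hr : 0 ≤ r)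
    (hrt : r ≤ t) (T : Finset (Fin (n + 1))) :
    volume (boxUnion A (T.piecewise (fun _ => t) fun _ => r) \ boxUnion A fun _ => r) ≤
      ENNReal.ofReal (∏ j, (2 * (r + T.piecewise (fun _ => t) (fun _ => r) j)) -
        ∏ _j : Fin (n + 1), (2 * (r + r))) := by
  induction T using Finset.induction_on with
  | empty => simp
  | insert i T hi ih =>
    set τ : Fin (n + 1) → ℝ := T.piecewise (fun _ => t) fun _ => r with hτ
    have hτr (j : Fin (n + 1)) : r ≤ τ j := by
      by_cases hj : j ∈ T <;> simp [hτ, hj, hrt]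
    have hτi : τ i = r := by simp [hτ, hi]
    have hstep := volume_boxUnion_update_sdiff_le hA hAs hr hτr i (q := t) (hτi.trans_le hrt)
    rw [Finset.piecewise_insert, ← hτ]
    have hP : ∏ j, (2 * (r + τ j)) ≤ ∏ j, (2 * (r + Function.update τ i t j)) := by
      refine Finset.prod_le_prod (fun j _ => by linarith [hτr j]) fun j _ => ?_
      rcases eq_or_ne j i with rfl | hj
      · rw [Function.update_self, hτi]; linarith
      · rw [Function.update_of_ne hj]
    have hP' : ∏ _j : Fin (n + 1), (2 * (r + r)) ≤ ∏ j, (2 * (r + τ j)) :=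
      Finset.prod_le_prod (fun j _ => by linarith) fun j _ => by linarith [hτr j]
    calc _ ≤ volume ((boxUnion A (Function.update τ i t) \ boxUnion A τ) ∪
          (boxUnion A τ \ boxUnion A fun _ => r)) := measure_mono fun x hx => by
          by_cases h : x ∈ boxUnion A τ
          · exact Or.inr ⟨h, hx.2⟩
          · exact Or.inl ⟨hx.1, h⟩
      _ ≤ _ := (measure_union_le _ _).trans (add_le_add hstep ih)
      _ = _ := by
        rw [← ENNReal.ofReal_add (by linarith) (by linarith)]
        congr 1
        ring

theorem volume_shell_le_of_subset_closedBall_pi {d : ℕ} (hd : 1 ≤ d) {A : Set (Fin d → ℝ)}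
    (hA : A.Finite) {s : Fin d → ℝ} {r t : ℝ} (hr : 0 ≤ r) (hrt : r ≤ t)
    (hAs : A ⊆ Metric.closedBall s r) :
    volume (ballUnion A t \ ballUnion A r) ≤
      ENNReal.ofReal (2 ^ (2 * d - 1) * (t ^ d - r ^ d)) := by
  obtain ⟨n, rfl⟩ : ∃ n, d = n + 1 := ⟨d - 1, by omega⟩
  have hAs' : ∀ a ∈ A, ∀ i, |s i - a i| ≤ r := by
    intro a ha i
    have := (dist_pi_le_iff hr).1 (Metric.mem_closedBall.1 (hAs ha)) i
    rwa [Real.dist_eq, abs_sub_comm] at this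
  have h := volume_boxUnion_piecewise_sdiff_le hA hAs' hr hrt Finset.univ
  rw [Finset.piecewise_univ, boxUnion_const A hr, boxUnion_const A (hr.trans hrt)] at h
  refine h.trans (ENNReal.ofReal_le_ofReal ?_)
  -- Telescoping leaves `(2 * (r + t)) ^ d - (4 * r) ^ d`. The power-mean inequality `(r + t) ^ d ≤
  -- 2 ^ (d - 1) * (r ^ d + t ^ d)` turns this into exactly the claimed constant.
  have hpow := add_pow_le hr (hr.trans hrt) (n + 1)
  simp only [Finset.prod_const, Finset.card_univ, Fintype.card_fin, mul_pow, Nat.add_sub_cancel]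
    at hpow ⊢
  have h2 : (2 : ℝ) ^ (2 * (n + 1) - 1) = 2 ^ (n + 1) * 2 ^ n := by
    rw [← pow_add]; congr 1; omega
  have h3 : (r + r) ^ (n + 1) = 2 * 2 ^ n * r ^ (n + 1) := by
    rw [← two_mul, mul_pow, pow_succ']
  rw [h2, h3]
  have h4 := mul_le_mul_of_nonneg_left hpow (show (0 : ℝ) ≤ 2 ^ (n + 1) by positivity)
  linarith

end Cube

/-! ### Translation to Minkowski sums and surface areas. -/

section ParallelSet

variable {d : ℕ}

theorem unitBall_eq_closedBall (d : ℕ) : unitBall d = Metric.closedBall 0 1 := by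
  ext x; simp [unitBall]

theorem convex_unitBall (d : ℕ) : Convex ℝ (unitBall d) := by
  rw [unitBall_eq_closedBall]; exact convex_closedBall 0 1

theorem unitCube_eq_preimage (d : ℕ) :
    unitCube d = WithLp.linearEquiv 2 ℝ (Fin d → ℝ) ⁻¹' Metric.closedBall 0 1 := by
  ext x
  simp [unitCube, pi_norm_le_iff_of_nonneg]

theorem convex_unitCube (d : ℕ) : Convex ℝ (unitCube d) := by
  rw [unitCube_eq_preimage]
  exact (convex_closedBall 0 1).linear_preimage (WithLp.linearEquiv 2 ℝ (Fin d → ℝ)).toLinearMap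

/-- Convexity gives `r • K + δ • K = (r + δ) • K`, which makes the surface area of a parallel set a
right derivative in the radius. -/
theorem parallelSet_parallelSet {K : Set (EuclideanSpace ℝ (Fin d))} (hK : Convex ℝ K)
    (A : Set (EuclideanSpace ℝ (Fin d))) {r δ : ℝ} (hr : 0 ≤ r) (hδ : 0 ≤ δ) :
    parallelSet K (parallelSet K A r) δ = parallelSet K A (r + δ) := by
  rw [parallelSet, parallelSet, parallelSet, add_assoc, hK.add_smul hr hδ]

theorem parallelSet_unitBall (A : Set (EuclideanSpace ℝ (Fin d))) {t : ℝ} (ht : 0 ≤ t) :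
    parallelSet (unitBall d) A t = ballUnion A t := by
  rw [parallelSet, unitBall_eq_closedBall, smul_closedBall _ _ zero_le_one, smul_zero, mul_one,
    Real.norm_of_nonneg ht]
  ext x
  simp only [Set.mem_add, mem_ballUnion, Metric.mem_closedBall, dist_zero_right]
  constructor
  · rintro ⟨a, ha, y, hy, rfl⟩
    exact ⟨a, ha, by simpa [dist_eq_norm] using hy⟩
  · rintro ⟨a, ha, hx⟩
    exact ⟨a, ha, x - a, by rwa [← dist_eq_norm], by abel⟩

/-- Cubes are the balls of `Fin d → ℝ`, so the norm-independent results apply after this transport,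
and `WithLp.ofLp` preserves volume. -/
theorem parallelSet_unitCube (A : Set (EuclideanSpace ℝ (Fin d))) {t : ℝ} (ht : 0 < t) :
    parallelSet (unitCube d) A t =
      WithLp.ofLp ⁻¹' ballUnion (WithLp.ofLp '' A : Set (Fin d → ℝ)) t := by
  ext x
  simp only [parallelSet, Set.mem_add, Set.mem_smul_set_iff_inv_smul_mem₀ ht.ne', unitCube,
    Set.mem_preimage, mem_ballUnion, Set.exists_mem_image, dist_pi_le_iff ht.le, Real.dist_eq,
    Set.mem_ofPred_eq, PiLp.smul_apply, smul_eq_mul, abs_mul, abs_of_pos (inv_pos.2 ht),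
    inv_mul_le_iff₀ ht, mul_one]
  constructor
  · rintro ⟨a, ha, y, hy, rfl⟩
    exact ⟨a, ha, fun i => by simpa using hy i⟩
  · rintro ⟨a, ha, hx⟩
    exact ⟨a, ha, x - a, fun i => by simpa using hx i, by abel⟩

theorem volume_parallelSet_unitCube {A : Set (EuclideanSpace ℝ (Fin d))} (hA : A.Finite) {t : ℝ}
    (ht : 0 < t) :
    volume (parallelSet (unitCube d) A t) =
      volume (ballUnion (WithLp.ofLp '' A : Set (Fin d → ℝ)) t) := by
  rw [parallelSet_unitCube A ht, (PiLp.volume_preserving_ofLp (Fin d)).measure_preimage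
    (isClosed_ballUnion (hA.image _) t).nullMeasurableSet]

theorem volume_parallelSet_unitCube_sdiff {A : Set (EuclideanSpace ℝ (Fin d))} (hA : A.Finite)
    {r t : ℝ} (hr : 0 < r) (ht : 0 < t) :
    volume (parallelSet (unitCube d) A t \ parallelSet (unitCube d) A r) =
      volume (ballUnion (WithLp.ofLp '' A : Set (Fin d → ℝ)) t \
        ballUnion (WithLp.ofLp '' A : Set (Fin d → ℝ)) r) := by
  rw [parallelSet_unitCube A hr, parallelSet_unitCube A ht, ← Set.preimage_sdiff,
    (PiLp.volume_preserving_ofLp (Fin d)).measure_preimage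
    ((isClosed_ballUnion (hA.image _) t).measurableSet.diff
      (isClosed_ballUnion (hA.image _) r).measurableSet).nullMeasurableSet]

theorem volume_shell_unitBall_le [NeZero d] {A : Set (EuclideanSpace ℝ (Fin d))} (hA : A.Finite)
    {r t : ℝ} (hr : 0 < r) (hrt : r ≤ t) :
    volume (ballUnion A t \ ballUnion A r) ≤ (packingNumberBall A r : ℝ≥0∞) *
      ENNReal.ofReal (2 ^ (d - 1) * unitBallVolume d * (t ^ d - r ^ d)) := by
  refine measure_shell_le_packingNumber_mul volume hr.le (fun B s hB hBs => ?_) hA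
  have h := measure_shell_le_of_subset_closedBall volume hB hr hrt hBs
  have hvol : volume (Metric.ball (0 : EuclideanSpace ℝ (Fin d)) 1) =
      ENNReal.ofReal (unitBallVolume d) := by
    rw [unitBallVolume, unitBall_eq_closedBall, Measure.addHaar_closedBall_eq_addHaar_ball,
      ENNReal.ofReal_toReal measure_ball_lt_top.ne]
  rw [finrank_euclideanSpace_fin, hvol, ← ENNReal.ofReal_mul'
    (show 0 ≤ unitBallVolume d from ENNReal.toReal_nonneg)] at h
  refine h.trans_eq ?_
  congr 1
  ring

theorem volume_shell_pi_le (hd : 1 ≤ d) {A : Set (EuclideanSpace ℝ (Fin d))} (hA : A.Finite)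
    {r t : ℝ} (hr : 0 < r) (hrt : r ≤ t) :
    volume (ballUnion (WithLp.ofLp '' A : Set (Fin d → ℝ)) t \
        ballUnion (WithLp.ofLp '' A : Set (Fin d → ℝ)) r) ≤
      (packingNumberCube A r : ℝ≥0∞) * ENNReal.ofReal (2 ^ (2 * d - 1) * (t ^ d - r ^ d)) :=
  measure_shell_le_packingNumber_mul volume hr.le
    (fun _ _ hB hBs => volume_shell_le_of_subset_closedBall_pi hd hB hr.le hrt hBs) (hA.image _)

theorem packingNumber_ne_top_of_finite {X : Type*} [PseudoEMetricSpace X] {A : Set X}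
    (hA : A.Finite) (ε : ℝ≥0) : (Metric.packingNumber ε A : ℝ≥0∞) ≠ ∞ := by
  simpa using ((Metric.packingNumber_le_encard_self (ε := ε) A).trans_lt hA.encard_lt_top).ne

theorem surfaceArea_congr {K A : Set (EuclideanSpace ℝ (Fin d))} {f : ℝ → ℝ≥0∞}
    (h : ∀ δ : ℝ, 0 < δ → (volume (parallelSet K A δ) - volume A) / ENNReal.ofReal δ = f δ) :
    lowerSurfaceArea K A = liminf f (𝓝[>] 0) ∧ upperSurfaceArea K A = limsup f (𝓝[>] 0) := by
  have h' : (fun δ : ℝ => (volume (parallelSet K A δ) - volume A) / ENNReal.ofReal δ)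
      =ᶠ[𝓝[>] 0] f := by
    filter_upwards [self_mem_nhdsWithin] with δ hδ using h δ hδ
  exact ⟨liminf_congr h', limsup_congr h'⟩

end ParallelSet

theorem mainTheorem5 (d : ℕ) (hd : 1 ≤ d) (A : Set (EuclideanSpace ℝ (Fin d))) (hA : A.Finite)
    (r : ℝ) (hr : 0 < r) :
    (∀ δ : ℝ, 0 < δ →
      volume (parallelSet (unitBall d) A (r + δ) \ parallelSet (unitBall d) A r) ≤
          (packingNumberBall A r : ℝ≥0∞) *
            ENNReal.ofReal (2 ^ (d - 1) * unitBallVolume d * ((r + δ) ^ d - r ^ d)) ∧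
      volume (parallelSet (unitCube d) A (r + δ) \ parallelSet (unitCube d) A r) ≤
          (packingNumberCube A r : ℝ≥0∞) *
            ENNReal.ofReal (2 ^ (2 * d - 1) * ((r + δ) ^ d - r ^ d))) ∧
    (lowerSurfaceArea (unitBall d) (parallelSet (unitBall d) A r) =
        upperSurfaceArea (unitBall d) (parallelSet (unitBall d) A r) ∧
      upperSurfaceArea (unitBall d) (parallelSet (unitBall d) A r) ≤
        (packingNumberBall A r : ℝ≥0∞) *
          ENNReal.ofReal (2 ^ (d - 1) * unitBallVolume d * d * r ^ (d - 1))) ∧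
    (lowerSurfaceArea (unitCube d) (parallelSet (unitCube d) A r) =
        upperSurfaceArea (unitCube d) (parallelSet (unitCube d) A r) ∧
      upperSurfaceArea (unitCube d) (parallelSet (unitCube d) A r) ≤
        (packingNumberCube A r : ℝ≥0∞) *
          ENNReal.ofReal (2 ^ (2 * d - 1) * d * r ^ (d - 1))) := by
  have : NeZero d := ⟨by omega⟩
  refine ⟨fun δ hδ => ⟨?_, ?_⟩, ?_, ?_⟩
  · rw [parallelSet_unitBall A hr.le, parallelSet_unitBall A (by linarith)]
    exact volume_shell_unitBall_le hA hr (by linarith)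
  · rw [volume_parallelSet_unitCube_sdiff hA hr (by linarith)]
    exact volume_shell_pi_le hd hA hr (by linarith)
  · have hN : (packingNumberBall A r : ℝ≥0∞) ≠ ∞ := packingNumber_ne_top_of_finite hA _
    have h := liminf_eq_limsup_and_limsup_le_of_shell_le volume hA hr hN
      (c := 2 ^ (d - 1) * unitBallVolume d) fun δ hδ => by
        rw [finrank_euclideanSpace_fin]
        exact volume_shell_unitBall_le hA hr (by linarith)
    rw [finrank_euclideanSpace_fin] at h
    obtain ⟨hl, hu⟩ := surfaceArea_congr (K := unitBall d) (A := parallelSet (unitBall d) A r)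
      fun δ hδ => by
        rw [parallelSet_parallelSet (convex_unitBall d) A hr.le hδ.le,
          parallelSet_unitBall A hr.le, parallelSet_unitBall A (by linarith)]
    rwa [hl, hu]
  · have hN : (packingNumberCube A r : ℝ≥0∞) ≠ ∞ :=
      packingNumber_ne_top_of_finite (hA.image _) _
    have h := liminf_eq_limsup_and_limsup_le_of_shell_le volume (hA.image WithLp.ofLp) hr hN
      (c := 2 ^ (2 * d - 1)) fun δ hδ => by
        rw [Module.finrank_fin_fun]
        exact volume_shell_pi_le hd hA hr (by linarith)
    rw [Module.finrank_fin_fun] at h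
    obtain ⟨hl, hu⟩ := surfaceArea_congr (K := unitCube d) (A := parallelSet (unitCube d) A r)
      fun δ hδ => by
        rw [parallelSet_parallelSet (convex_unitCube d) A hr.le hδ.le,
          volume_parallelSet_unitCube hA hr, volume_parallelSet_unitCube hA (by linarith)]
    rwa [hl, hu]
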